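/- Let $R$ be any commutative ring. Let $(O,q)$ be an octonion algebra over $R$: a unital, not necessarily associative $R$-algebra $O$, free of rank $8$ as an $R$-module, with $R\hookrightarrow O$ via $r\mapsto r\cdot 1$, together with a quadratic form $q$ satisfying $q(xy)=q(x)q(y)$ for all $x,y\in O$ and non-degenerate in the sense that $\langle x,y\rangle := q(x+y)-q(x)-q(y)=0$ for all $y\in O$ implies $x=0$. Let $\overline{\alpha}=\langle\alpha,1\rangle 1-\alpha$ be the standard involution of $O$, and for $\alpha\in O$ let $L_\alpha\in\operatorname{End}(O)=\operatorname{End}_R(O)$ be left multiplication by $\alpha$. For $n\ge 0$ let $V=O\oplus H(R^n)$, where $H(R^n)=R^n\oplus (R^n)^*$, with the quadratic form $q(\alpha,v,w)=q(\alpha)+v\cdot w^{\intercal}$, and let $Cl(V)$ be its Clifford algebra (with $x^2=q(x)$ for $x\in V$), which is $\mathbb Z_2$-graded as usual. For $\alpha\in O$, $v=(a_1,\dots,a_n)$ and $w=(b_1,\dots,b_n)$ define matrices over $\operatorname{End}(O)$ by $Z'_0=(L_\alpha)$, $\overline{Z'_0}=(L_{\overline\alpha})$ and, for $1\le i\le n$,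 $$Z'_i=\begin{pmatrix} a_i & Z'_{i-1}\\ -\overline{Z'_{i-1}} & b_i\end{pmatrix},\qquad \overline{Z'_i}=\begin{pmatrix} b_i & -Z'_{i-1}\\ \overline{Z'_{i-1}} & a_i\end{pmatrix},$$ where scalars denote scalar matrices; thus $Z'_i$ has size $2^i\times 2^i$ and $Z'_1=\begin{pmatrix} a_1 & L_\alpha\\ -L_{\overline\alpha} & b_1\end{pmatrix}$. Give $M_{2^{n+1}}(\operatorname{End}(O))$ the $\mathbb Z_2$-grading whose even and odd elements are the matrices of the block form $\begin{pmatrix} *&0\\0&*\end{pmatrix}$ and $\begin{pmatrix} 0&*\\ *&0\end{pmatrix}$, with blocks of size $2^n\times 2^n$. Then the map $$(\alpha,v,w)\longmapsto \begin{pmatrix} 0 & Z'_n(\alpha,v,w)\\ \overline{Z'_n(\alpha,v,w)} & 0\end{pmatrix}$$ on $V$ extends to a $\mathbb Z_2$-graded $R$-algebra homomorphism $\phi: Cl(V)\to M_{2^{n+1}}(\operatorname{End}(O))$ (necessarily unique), and $\phi$ is injective. Moreover $Cl(V)$ and $M_{2^{n+1}}(\operatorname{End}(O))$ are both free $R$-modules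 of rank $2^{2n+8}$. -/

import Mathlib

/-- `M` is a free `R`-module of rank `r`, i.e. it has a basis with `r` elements. (Over a nontrivial
ring this says that `M` is free with `Module.finrank R M = r`; over the zero ring, where the rank
of a free module is not unique, it still makes sense.) -/
def IsFreeOfRank (R M : Type*) [CommRing R] [AddCommGroup M] [Module R M] (r : ℕ) : Prop :=
  Nonempty (Module.Basis (Fin r) R M)

section CompositionAlgebra

variable {R O : Type*} [CommRing R] [NonAssocRing O] [Module R O]

/-- A unital, not necessarily associative `R`-algebra `O` with a quadratic form `q` is a
composition algebra: `O` is free of finite rank, it contains a copy of `R`, and `q` is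
multiplicative with a non-degenerate associated bilinear form `⟨x, y⟩ = q (x + y) - q x - q y`. -/
structure IsCompositionAlgebra (q : QuadraticForm R O) : Prop where
  free : Module.Free R O
  finite : Module.Finite R O
  injective_smul_one : Function.Injective (fun r : R => r • (1 : O))
  nondegenerate : ∀ x : O, (∀ y : O, QuadraticMap.polar q x y = 0) → x = 0
  map_mul : ∀ x y : O, q (x * y) = q x * q y

/-- An octonion algebra is a composition algebra of rank `8`. -/
structure IsOctonionAlgebra (q : QuadraticForm R O) : Prop extends IsCompositionAlgebra q where
  rank_eq : IsFreeOfRank R O 8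

/-- The standard involution `α ↦ ᾱ = ⟨α, 1⟩ 1 - α` of a composition algebra. (It is the only
`R`-linear map with `α ᾱ = q α` for all `α`.) -/
def octConj (q : QuadraticForm R O) (α : O) : O :=
  QuadraticMap.polar q α 1 • (1 : O) - α

end CompositionAlgebra

/-- The hyperbolic space `H(Rⁿ) = Rⁿ ⊕ Rⁿ*`, in coordinates: the form `(v, w) ↦ v · wᵀ`. -/
def hyperbolicForm (R : Type*) [CommRing R] (n : ℕ) :
    QuadraticForm R ((Fin n → R) × (Fin n → R)) :=
  ∑ i : Fin n, QuadraticMap.linMulLin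
    ((LinearMap.proj i).comp (LinearMap.fst R (Fin n → R) (Fin n → R)))
    ((LinearMap.proj i).comp (LinearMap.snd R (Fin n → R) (Fin n → R)))

theorem hyperbolicForm_apply (R : Type*) [CommRing R] (n : ℕ) (v w : Fin n → R) :
    hyperbolicForm R n (v, w) = v ⬝ᵥ w := by
  simp [hyperbolicForm, dotProduct]

/-- The quadratic form `(α, v, w) ↦ q α + v · wᵀ` on `V = O ⊕ H(Rⁿ)`. -/
def octSpaceForm {R O : Type*} [CommRing R] [NonAssocRing O] [Module R O]
    (q : QuadraticForm R O) (n : ℕ) :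
    QuadraticForm R (O × ((Fin n → R) × (Fin n → R))) :=
  q.prod (hyperbolicForm R n)

theorem octSpaceForm_apply {R O : Type*} [CommRing R] [NonAssocRing O] [Module R O]
    (q : QuadraticForm R O) (n : ℕ) (α : O) (v w : Fin n → R) :
    octSpaceForm q n (α, v, w) = q α + v ⬝ᵥ w := by
  simp [octSpaceForm, hyperbolicForm_apply]

section Matrices

/-- The splitting of the `2 ^ (n + 1)` indices into the first and the last `2 ^ n`. -/
def halvesEquiv (n : ℕ) : Fin (2 ^ n) ⊕ Fin (2 ^ n) ≃ Fin (2 ^ (n + 1)) :=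
  finSumFinEquiv.trans (finCongr (by rw [pow_succ, mul_two]))

/-- The matrix of size `2 ^ (n + 1)` with the blocks `A`, `B` (top row) and `C`, `D` (bottom row)
of size `2 ^ n`. -/
def blockMatrix {E : Type*} {n : ℕ} (A B C D : Matrix (Fin (2 ^ n)) (Fin (2 ^ n)) E) :
    Matrix (Fin (2 ^ (n + 1))) (Fin (2 ^ (n + 1))) E :=
  Matrix.reindex (halvesEquiv n) (halvesEquiv n) (Matrix.fromBlocks A B C D)

section BlockGrading

variable {E : Type*} {n : ℕ}

theorem exists_eq_blockMatrix (M : Matrix (Fin (2 ^ (n + 1))) (Fin (2 ^ (n + 1))) E) :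
    ∃ A B C D : Matrix (Fin (2 ^ n)) (Fin (2 ^ n)) E, M = blockMatrix A B C D := by
  let N := (Matrix.reindex (halvesEquiv n) (halvesEquiv n)).symm M
  refine ⟨N.toBlocks₁₁, N.toBlocks₁₂, N.toBlocks₂₁, N.toBlocks₂₂, ?_⟩
  rw [blockMatrix, Matrix.fromBlocks_toBlocks]
  exact (Equiv.apply_symm_apply _ M).symm

theorem blockMatrix_inj {A B C D A' B' C' D' : Matrix (Fin (2 ^ n)) (Fin (2 ^ n)) E} :
    blockMatrix A B C D = blockMatrix A' B' C' D' ↔ A = A' ∧ B = B' ∧ C = C' ∧ D = D' := by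
  rw [blockMatrix, blockMatrix, EmbeddingLike.apply_eq_iff_eq, Matrix.fromBlocks_inj]

variable [Ring E]

theorem blockMatrix_zero : blockMatrix (0 : Matrix (Fin (2 ^ n)) (Fin (2 ^ n)) E) 0 0 0 = 0 := by
  simp [blockMatrix]

theorem blockMatrix_one : blockMatrix (1 : Matrix (Fin (2 ^ n)) (Fin (2 ^ n)) E) 0 0 1 = 1 := by
  simp [blockMatrix]

theorem blockMatrix_add (A B C D A' B' C' D' : Matrix (Fin (2 ^ n)) (Fin (2 ^ n)) E) :
    blockMatrix A B C D + blockMatrix A' B' C' D' =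
      blockMatrix (A + A') (B + B') (C + C') (D + D') := by
  simp only [blockMatrix, Matrix.reindex_apply, ← Matrix.fromBlocks_add]
  rfl

theorem blockMatrix_smul {R : Type*} [CommRing R] [Algebra R E] (c : R)
    (A B C D : Matrix (Fin (2 ^ n)) (Fin (2 ^ n)) E) :
    c • blockMatrix A B C D = blockMatrix (c • A) (c • B) (c • C) (c • D) := by
  simp only [blockMatrix, Matrix.reindex_apply, ← Matrix.fromBlocks_smul]
  rfl

theorem blockMatrix_mul (A B C D A' B' C' D' : Matrix (Fin (2 ^ n)) (Fin (2 ^ n)) E) :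
    blockMatrix A B C D * blockMatrix A' B' C' D' =
      blockMatrix (A * A' + B * C') (A * B' + B * D') (C * A' + D * C') (C * B' + D * D') := by
  simp [blockMatrix, Matrix.reindex_apply, Matrix.fromBlocks_multiply]

/-- The grading of the algebra of matrices of size `2 ^ (n + 1)` by `ZMod 2`: the even (`i = 0`)
and odd (`i = 1`) elements are the matrices of the form `(* 0; 0 *)` and `(0 *; * 0)`. -/
def blockGrading (R E : Type*) [CommRing R] [Ring E] [Algebra R E] (n : ℕ) (i : ZMod 2) :
    Submodule R (Matrix (Fin (2 ^ (n + 1))) (Fin (2 ^ (n + 1))) E) where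
  carrier := {M | ∃ A B : Matrix (Fin (2 ^ n)) (Fin (2 ^ n)) E,
    M = if i = 0 then blockMatrix A 0 0 B else blockMatrix 0 A B 0}
  zero_mem' := ⟨0, 0, by simp [blockMatrix_zero]⟩
  add_mem' := by
    rintro _ _ ⟨A, B, rfl⟩ ⟨A', B', rfl⟩
    refine ⟨A + A', B + B', ?_⟩
    split_ifs <;> simp [blockMatrix_add]
  smul_mem' := by
    rintro c _ ⟨A, B, rfl⟩
    refine ⟨c • A, c • B, ?_⟩
    split_ifs <;> simp [blockMatrix_smul]

variable (R : Type*) [CommRing R] [Algebra R E]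

theorem mem_blockGrading_zero {M : Matrix (Fin (2 ^ (n + 1))) (Fin (2 ^ (n + 1))) E} :
    M ∈ blockGrading R E n 0 ↔
      ∃ A B : Matrix (Fin (2 ^ n)) (Fin (2 ^ n)) E, M = blockMatrix A 0 0 B := by
  simp [blockGrading]

theorem mem_blockGrading_one {M : Matrix (Fin (2 ^ (n + 1))) (Fin (2 ^ (n + 1))) E} :
    M ∈ blockGrading R E n 1 ↔
      ∃ A B : Matrix (Fin (2 ^ n)) (Fin (2 ^ n)) E, M = blockMatrix 0 A B 0 := by
  simp [blockGrading]

instance : SetLike.GradedMonoid (blockGrading R E n) where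
  one_mem := (mem_blockGrading_zero R).2 ⟨1, 1, blockMatrix_one.symm⟩
  mul_mem := by
    rintro i j _ _ ⟨A, B, rfl⟩ ⟨A', B', rfl⟩
    have h : ∀ k : ZMod 2, k = 0 ∨ k = 1 := by decide
    rcases h i with rfl | rfl <;> rcases h j with rfl | rfl
    · exact ⟨A * A', B * B', by simp [blockMatrix_mul]⟩
    · exact ⟨A * A', B * B', by simp [blockMatrix_mul]⟩
    · exact ⟨A * B', B * A', by simp [blockMatrix_mul]⟩
    · exact ⟨A * B', B * A', by simp [blockMatrix_mul, show (1 : ZMod 2) + 1 = 0 from rfl]⟩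

theorem blockGrading_isInternal : DirectSum.IsInternal (blockGrading R E n) := by
  rw [DirectSum.isInternal_submodule_iff_isCompl (blockGrading R E n)
    (show (0 : ZMod 2) ≠ 1 by decide) (Set.ext (by decide))]
  refine ⟨Submodule.disjoint_def.2 fun M h0 h1 => ?_, codisjoint_iff.2 (eq_top_iff.2 ?_)⟩
  · obtain ⟨A, D, rfl⟩ := (mem_blockGrading_zero R).1 h0
    obtain ⟨B, C, h⟩ := (mem_blockGrading_one R).1 h1
    obtain ⟨rfl, -, -, rfl⟩ := blockMatrix_inj.1 h
    exact blockMatrix_zero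
  · rintro M -
    obtain ⟨A, B, C, D, rfl⟩ := exists_eq_blockMatrix M
    refine Submodule.mem_sup.2 ⟨blockMatrix A 0 0 D, (mem_blockGrading_zero R).2 ⟨A, D, rfl⟩,
      blockMatrix 0 B C 0, (mem_blockGrading_one R).2 ⟨B, C, rfl⟩, ?_⟩
    simp [blockMatrix_add]

noncomputable instance : GradedAlgebra (blockGrading R E n) where
  toDecomposition := (blockGrading_isInternal R).chooseDecomposition

end BlockGrading

variable {R O : Type*} [CommRing R] [NonAssocRing O] [Module R O]
  [IsScalarTower R O O] [SMulCommClass R O O]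

mutual

/-- The matrices `Z'ₙ(α, v, w)` over `End(O)`, with `v = (a₁, …, aₙ)` and `w = (b₁, …, bₙ)`:
`Z'ₙ = (aₙ, Z'ₙ₋₁; -Z̄'ₙ₋₁, bₙ)`, with scalars standing for scalar matrices. The recursion starts
at the `1 × 1` matrices `Z'₀ = (L_α)` and `Z̄'₀ = (L_ᾱ)`, so that
`Z'₁ = (a₁, L_α; -L_ᾱ, b₁)`. -/
def octZ (q : QuadraticForm R O) (α : O) : (n : ℕ) → (v w : Fin n → R) →
    Matrix (Fin (2 ^ n)) (Fin (2 ^ n)) (Module.End R O)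
  | 0, _, _ => Matrix.of fun _ _ => LinearMap.mulLeft R α
  | n + 1, v, w => blockMatrix
      (v (Fin.last n) • 1) (octZ q α n (Fin.init v) (Fin.init w))
      (-octZBar q α n (Fin.init v) (Fin.init w)) (w (Fin.last n) • 1)

/-- The matrices `Z̄'ₙ(α, v, w) = (bₙ, -Z'ₙ₋₁; Z̄'ₙ₋₁, aₙ)`. -/
def octZBar (q : QuadraticForm R O) (α : O) : (n : ℕ) → (v w : Fin n → R) →
    Matrix (Fin (2 ^ n)) (Fin (2 ^ n)) (Module.End R O)
  | 0, _, _ => Matrix.of fun _ _ => LinearMap.mulLeft R (octConj q α)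
  | n + 1, v, w => blockMatrix
      (w (Fin.last n) • 1) (-octZ q α n (Fin.init v) (Fin.init w))
      (octZBar q α n (Fin.init v) (Fin.init w)) (v (Fin.last n) • 1)

end

/-- The matrix `(0, Z'ₙ(α, v, w); Z̄'ₙ(α, v, w), 0)` in `M_{2ⁿ⁺¹}(End(O))`. -/
def octPhi (q : QuadraticForm R O) (n : ℕ) (x : O × ((Fin n → R) × (Fin n → R))) :
    Matrix (Fin (2 ^ (n + 1))) (Fin (2 ^ (n + 1))) (Module.End R O) :=
  blockMatrix 0 (octZ q x.1 n x.2.1 x.2.2) (octZBar q x.1 n x.2.1 x.2.2) 0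

end Matrices

-- Ranks of free modules.

section FreeOfRank

variable {R M N : Type*} [CommRing R] [AddCommGroup M] [Module R M] [AddCommGroup N] [Module R N]

-- Multiplicativity of `q` gives `L_ᾱ L_α = L_α L_ᾱ = q α`, a substitute for associativity. Hence
-- `Z'` and `Z̄'` multiply to the scalar `q α + v ⬝ᵥ w` in both orders, and the universal property
-- yields `φ`.
--
-- For injectivity the form on `V` is only non-degenerate, perhaps not unimodular, and 2 may be a
-- zero divisor, so simplicity of the Clifford algebra is not available. Instead, `diag(1, -1)`
-- anticommutes with the image of `V`, so `ker φ` is stable under the grade involution. It therefore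
-- contains `v x - involute x v`, the contraction of `x` by `polar v` (`ι_mul_sub_involute_mul_ι`).
-- Repeated contraction kills every element, so by induction on the number of contractions needed,
-- all contractions of a kernel element `x` by `polar v` vanish. Freeness and non-degeneracy extend
-- this to all functionals (`contractLeft_eq_zero_of_polarBilin`). Then `x` is a scalar, hence zero,
-- as `φ` is injective on scalars.
--
-- The same injectivity embeds the scalars in the Clifford algebra, which is what makes its ordered
-- monomials a basis.

theorem IsFreeOfRank.of_basis {ι : Type*} [Fintype ι] (b : Module.Basis ι R M) :
    IsFreeOfRank R M (Fintype.card ι) :=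
  ⟨b.reindex (Fintype.equivFin ι)⟩

theorem IsFreeOfRank.of_linearEquiv {r : ℕ} (h : IsFreeOfRank R M r) (e : M ≃ₗ[R] N) :
    IsFreeOfRank R N r :=
  h.map fun b => b.map e

theorem IsFreeOfRank.prod {r s : ℕ} (hM : IsFreeOfRank R M r) (hN : IsFreeOfRank R N s) :
    IsFreeOfRank R (M × N) (r + s) := by
  obtain ⟨b⟩ := hM
  obtain ⟨c⟩ := hN
  simpa using IsFreeOfRank.of_basis (b.prod c)

theorem IsFreeOfRank.end {r : ℕ} (hM : IsFreeOfRank R M r) :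
    IsFreeOfRank R (Module.End R M) (r * r) := by
  obtain ⟨b⟩ := hM
  simpa using IsFreeOfRank.of_basis (b.end)

theorem IsFreeOfRank.matrix {r : ℕ} (hM : IsFreeOfRank R M r) (k l : ℕ) :
    IsFreeOfRank R (Matrix (Fin k) (Fin l) M) (k * l * r) := by
  obtain ⟨b⟩ := hM
  simpa [mul_assoc] using IsFreeOfRank.of_basis (b.matrix (Fin k) (Fin l))

end FreeOfRank

-- Ordered monomials span the Clifford algebra.

namespace CliffordAlgebra

variable {R M ι' : Type*} [CommRing R] [AddCommGroup M] [Module R M] (Q : QuadraticForm R M)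

/-- The span of the products of subsequences of `ι (b i₁), …, ι (b iₖ)`, where `i₁, …, iₖ` are the
entries of a list. -/
def monomialSpan (b : ι' → M) : List ι' → Submodule R (CliffordAlgebra Q)
  | [] => LinearMap.range (Algebra.linearMap R (CliffordAlgebra Q))
  | i :: l => monomialSpan b l ⊔ (monomialSpan b l).map (LinearMap.mulLeft R (ι Q (b i)))

variable {Q}

theorem mem_monomialSpan_cons {b : ι' → M} {i : ι'} {l : List ι'} {x : CliffordAlgebra Q} :
    x ∈ monomialSpan Q b (i :: l) ↔
      ∃ y ∈ monomialSpan Q b l, ∃ z ∈ monomialSpan Q b l, x = y + ι Q (b i) * z := by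
  simp only [monomialSpan, Submodule.mem_sup, Submodule.mem_map, LinearMap.mulLeft_apply]
  constructor
  · rintro ⟨y, hy, _, ⟨z, hz, rfl⟩, rfl⟩
    exact ⟨y, hy, z, hz, rfl⟩
  · rintro ⟨y, hy, z, hz, rfl⟩
    exact ⟨y, hy, _, ⟨z, hz, rfl⟩, rfl⟩

theorem algebraMap_mem_monomialSpan (b : ι' → M) (l : List ι') (r : R) :
    algebraMap R (CliffordAlgebra Q) r ∈ monomialSpan Q b l := by
  induction l with
  | nil => exact ⟨r, rfl⟩
  | cons i l ih => exact Submodule.mem_sup_left ih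

/-- A generator moves right past earlier ones at the cost of a scalar `polar` term, until it meets
its own slot, where its square is a scalar. -/
theorem ι_mul_mem_monomialSpan (b : ι' → M) {l : List ι'} {i : ι'} (hi : i ∈ l)
    {x : CliffordAlgebra Q} (hx : x ∈ monomialSpan Q b l) :
    ι Q (b i) * x ∈ monomialSpan Q b l := by
  induction l generalizing x with
  | nil => simp at hi
  | cons j l ih =>
    obtain ⟨y, hy, z, hz, rfl⟩ := mem_monomialSpan_cons.1 hx
    rw [mul_add, ← mul_assoc, mem_monomialSpan_cons]
    by_cases hij : i = j
    · subst hij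
      refine ⟨Q (b i) • z, Submodule.smul_mem _ _ hz, y, hy, ?_⟩
      rw [ι_sq_scalar, ← Algebra.smul_def, add_comm]
    · have hil : i ∈ l := (List.mem_cons.1 hi).resolve_left hij
      refine ⟨ι Q (b i) * y + QuadraticMap.polar Q (b i) (b j) • z,
        add_mem (ih hil hy) (Submodule.smul_mem _ _ hz), -(ι Q (b i) * z), neg_mem (ih hil hz), ?_⟩
      rw [ι_mul_ι_comm, sub_mul, ← Algebra.smul_def, mul_neg, mul_assoc]
      abel

theorem monomialSpan_eq_top (b : ι' → M) (hb : Submodule.span R (Set.range b) = ⊤) {l : List ι'}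
    (hl : ∀ i, i ∈ l) : monomialSpan Q b l = ⊤ := by
  refine (Submodule.eq_top_iff').2 fun x => ?_
  induction x using CliffordAlgebra.left_induction with
  | algebraMap r => exact algebraMap_mem_monomialSpan b l r
  | add x y hx hy => exact add_mem hx hy
  | ι_mul x m hx =>
    have hm : m ∈ Submodule.span R (Set.range b) := hb ▸ Submodule.mem_top
    induction hm using Submodule.span_induction with
    | mem m hm =>
      obtain ⟨i, rfl⟩ := hm
      exact ι_mul_mem_monomialSpan b (hl i) hx
    | zero => simp
    | add u v _ _ hu hv =>
      rw [map_add, add_mul]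
      exact add_mem hu hv
    | smul r u _ hu =>
      rw [map_smul, smul_mul_assoc]
      exact Submodule.smul_mem _ _ hu

theorem contractLeft_eq_zero_of_mem_monomialSpan {b : ι' → M} {l : List ι'}
    {d : Module.Dual R M} (hd : ∀ i ∈ l, d (b i) = 0) {x : CliffordAlgebra Q}
    (hx : x ∈ monomialSpan Q b l) : contractLeft d x = 0 := by
  induction l generalizing x with
  | nil =>
    obtain ⟨r, rfl⟩ := hx
    exact contractLeft_algebraMap Q d r
  | cons j l ih =>
    obtain ⟨y, hy, z, hz, rfl⟩ := mem_monomialSpan_cons.1 hx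
    have hl : ∀ i ∈ l, d (b i) = 0 := fun i hi => hd i (List.mem_cons_of_mem _ hi)
    rw [map_add, contractLeft_ι_mul, ih hl hy, ih hl hz, hd j List.mem_cons_self]
    simp

-- Contraction by dual basis vectors: independence of the monomials, and scalars as common kernel.

section Basis

variable (b : Module.Basis ι' R M)

/-- Contraction by the dual vector of `b i` acts as `∂/∂(b i)`: it recovers `z`, so `y + ι (b i) *
z` determines both `y` and `z`. -/
theorem coord_contractLeft_add_ι_mul {i : ι'} {l : List ι'} (hi : i ∉ l) {y z : CliffordAlgebra Q}
    (hy : y ∈ monomialSpan Q b l) (hz : z ∈ monomialSpan Q b l) :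
    contractLeft (b.coord i) (y + ι Q (b i) * z) = z := by
  have hd : ∀ j ∈ l, b.coord i (b j) = 0 := fun j hj => by
    rw [Module.Basis.coord_apply, Module.Basis.repr_self,
      Finsupp.single_eq_of_ne]
    rintro rfl
    exact hi hj
  rw [map_add, contractLeft_ι_mul, contractLeft_eq_zero_of_mem_monomialSpan hd hy,
    contractLeft_eq_zero_of_mem_monomialSpan hd hz]
  simp

theorem mem_range_algebraMap_of_mem_monomialSpan {l : List ι'} (hl : l.Nodup)
    {x : CliffordAlgebra Q} (hx : x ∈ monomialSpan Q b l)
    (h : ∀ d : Module.Dual R M, contractLeft d x = 0) :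
    ∃ r : R, algebraMap R (CliffordAlgebra Q) r = x := by
  induction l with
  | nil => exact hx
  | cons i l ih =>
    obtain ⟨hi, hl⟩ := List.nodup_cons.1 hl
    obtain ⟨y, hy, z, hz, rfl⟩ := mem_monomialSpan_cons.1 hx
    have hz0 : z = 0 := by
      rw [← coord_contractLeft_add_ι_mul b hi hy hz, h]
    subst hz0
    refine ih hl ?_
    simpa using hy

theorem mem_range_algebraMap_of_contractLeft_eq_zero [Fintype ι']
    (b : Module.Basis ι' R M) {x : CliffordAlgebra Q}
    (h : ∀ d : Module.Dual R M, contractLeft d x = 0) :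
    ∃ r : R, algebraMap R (CliffordAlgebra Q) r = x :=
  mem_range_algebraMap_of_mem_monomialSpan b (Finset.nodup_toList Finset.univ)
    (monomialSpan_eq_top b b.span_eq (l := Finset.univ.toList) (by simp) ▸ Submodule.mem_top) h

theorem isFreeOfRank_monomialSpan
    (hinj : Function.Injective (algebraMap R (CliffordAlgebra Q))) {l : List ι'} (hl : l.Nodup) :
    IsFreeOfRank R (monomialSpan Q b l) (2 ^ l.length) := by
  induction l with
  | nil =>
    have h := IsFreeOfRank.of_basis (Module.Basis.singleton Unit R)
    exact h.of_linearEquiv (LinearEquiv.ofInjective (Algebra.linearMap R (CliffordAlgebra Q)) hinj)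
  | cons i l ih =>
    obtain ⟨hi, hl⟩ := List.nodup_cons.1 hl
    let S := monomialSpan Q b l
    let f : (S × S) →ₗ[R] CliffordAlgebra Q :=
      S.subtype.coprod ((LinearMap.mulLeft R (ι Q (b i))).comp S.subtype)
    have hf : Function.Injective f := by
      rw [← LinearMap.ker_eq_bot, LinearMap.ker_eq_bot']
      rintro ⟨⟨y, hy⟩, ⟨z, hz⟩⟩ h
      have h' : y + ι Q (b i) * z = 0 := by simpa [f] using h
      have hz0 : z = 0 := by
        rw [← coord_contractLeft_add_ι_mul b hi hy hz, h', map_zero]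
      subst hz0
      have hy0 : y = 0 := by simpa using h'
      subst hy0
      rfl
    have hr : LinearMap.range f = monomialSpan Q b (i :: l) := by
      rw [LinearMap.range_coprod, LinearMap.range_comp, Submodule.range_subtype]
      rfl
    have h := ((ih hl).prod (ih hl)).of_linearEquiv
      ((LinearEquiv.ofInjective f hf).trans (LinearEquiv.ofEq _ _ hr))
    rwa [List.length_cons, pow_succ, mul_two]

end Basis

/-- The Clifford algebra of a free module of rank `m` is free of rank `2 ^ m`, as soon as it
contains the scalars. -/
theorem isFreeOfRank {m : ℕ} (hM : IsFreeOfRank R M m)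
    (hinj : Function.Injective (algebraMap R (CliffordAlgebra Q))) :
    IsFreeOfRank R (CliffordAlgebra Q) (2 ^ m) := by
  obtain ⟨b⟩ := hM
  have h := isFreeOfRank_monomialSpan b hinj (Finset.nodup_toList Finset.univ)
  rw [monomialSpan_eq_top b b.span_eq (by simp)] at h
  simpa using h.of_linearEquiv Submodule.topEquiv

-- Twisted commutators as contractions.

/-- Both sides vanish on scalars and obey the same antiderivation rule under left multiplication by
a vector. -/
theorem ι_mul_sub_involute_mul_ι (v : M) (x : CliffordAlgebra Q) :
    ι Q v * x - involute x * ι Q v = contractLeft (QuadraticMap.polarBilin Q v) x := by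
  induction x using CliffordAlgebra.left_induction with
  | algebraMap r =>
    rw [AlgHom.commutes, Algebra.commutes, sub_self, contractLeft_algebraMap]
  | add x y hx hy =>
    rw [map_add, map_add, ← hx, ← hy, mul_add, add_mul]
    abel
  | ι_mul x u hx =>
    rw [contractLeft_ι_mul, ← hx, map_mul, involute_ι, ← mul_assoc, ι_mul_ι_comm, sub_mul,
      ← Algebra.smul_def, QuadraticMap.polarBilin_apply_apply, mul_sub, neg_mul, neg_mul,
      mul_assoc, mul_assoc]
    abel

/-- Over a finite free module, a contraction that kills an element for all functionals
`polar Q v`, `Q` non-degenerate, kills it for all functionals. -/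
theorem contractLeft_eq_zero_of_polarBilin {m r : ℕ} (hM : IsFreeOfRank R M m)
    (hC : IsFreeOfRank R (CliffordAlgebra Q) r)
    (hQ : ∀ u : M, (∀ v : M, QuadraticMap.polar Q u v = 0) → u = 0) {x : CliffordAlgebra Q}
    (h : ∀ v : M, contractLeft (QuadraticMap.polarBilin Q v) x = 0) (d : Module.Dual R M) :
    contractLeft d x = 0 := by
  obtain ⟨b⟩ := hM
  obtain ⟨c⟩ := hC
  refine c.ext_elem fun k => ?_
  let g : Module.Dual R M →ₗ[R] R := (c.coord k).comp (contractLeft.flip x)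
  -- By reflexivity of `M`, the functional `g` on the dual is evaluation at this vector.
  let u : M := ∑ i, g (b.coord i) • b i
  have hg : ∀ d : Module.Dual R M, d u = g d := fun d => by
    conv_rhs => rw [← b.sum_dual_apply_smul_coord d]
    simp only [u, map_sum, map_smul, smul_eq_mul, mul_comm]
  have hu : u = 0 := hQ u fun v => by
    rw [QuadraticMap.polar_comm, ← QuadraticMap.polarBilin_apply_apply, hg]
    simp [g, h]
  have := hg d
  rw [hu, map_zero] at this
  simpa [g] using this.symm

-- The filtration by iterated contraction.

variable (Q) in
/-- The elements of the Clifford algebra that are killed by any `k` successive contractions. -/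
def contractLeftKer : ℕ → Submodule R (CliffordAlgebra Q)
  | 0 => ⊥
  | k + 1 => ⨅ d : Module.Dual R M, (contractLeftKer k).comap (contractLeft d)

theorem mem_contractLeftKer_succ {k : ℕ} {x : CliffordAlgebra Q} :
    x ∈ contractLeftKer Q (k + 1) ↔ ∀ d : Module.Dual R M, contractLeft d x ∈
      contractLeftKer Q k := by
  simp [contractLeftKer, Submodule.mem_iInf]

theorem contractLeftKer_mono : Monotone (contractLeftKer Q) := by
  refine monotone_nat_of_le_succ fun k => ?_
  induction k with
  | zero => exact bot_le
  | succ k ih =>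
    exact fun x hx => mem_contractLeftKer_succ.2 fun d =>
      ih (mem_contractLeftKer_succ.1 hx d)

theorem ι_mul_mem_contractLeftKer (v : M) {k : ℕ} {x : CliffordAlgebra Q}
    (hx : x ∈ contractLeftKer Q k) : ι Q v * x ∈ contractLeftKer Q (k + 1) := by
  induction k generalizing x with
  | zero =>
    have h0 : x = 0 := hx
    simp [h0]
  | succ k ih =>
    refine mem_contractLeftKer_succ.2 fun d => ?_
    rw [contractLeft_ι_mul]
    exact sub_mem (Submodule.smul_mem _ _ hx) (ih (mem_contractLeftKer_succ.1 hx d))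

theorem exists_mem_contractLeftKer (x : CliffordAlgebra Q) : ∃ k, x ∈ contractLeftKer Q k := by
  induction x using CliffordAlgebra.left_induction with
  | algebraMap r =>
    refine ⟨1, mem_contractLeftKer_succ.2 fun d => ?_⟩
    rw [contractLeft_algebraMap]
    exact zero_mem _
  | add x y hx hy =>
    obtain ⟨k, hk⟩ := hx
    obtain ⟨l, hl⟩ := hy
    exact ⟨max k l, add_mem (contractLeftKer_mono (le_max_left k l) hk)
      (contractLeftKer_mono (le_max_right k l) hl)⟩
  | ι_mul x v hx =>
    obtain ⟨k, hk⟩ := hx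
    exact ⟨k + 1, ι_mul_mem_contractLeftKer v hk⟩

-- Injectivity and grading of homomorphisms.

section AlgHom

variable {A : Type*} [Ring A] [Algebra R A] (φ : CliffordAlgebra Q →ₐ[R] A)

/-- When `T` is a unit, conjugation by it realizes the grade involution on the image, so `ker φ` is
stable under `involute`. -/
theorem map_involute_mul {T : A} (hT : ∀ v, φ (ι Q v) * T = -(T * φ (ι Q v)))
    (x : CliffordAlgebra Q) : φ (involute x) * T = T * φ x := by
  induction x using CliffordAlgebra.left_induction with
  | algebraMap r => rw [AlgHom.commutes, AlgHom.commutes, Algebra.commutes]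
  | add x y hx hy => rw [map_add, map_add, map_add, add_mul, mul_add, hx, hy]
  | ι_mul x u hx =>
    rw [map_mul, map_mul, involute_ι, mul_assoc, hx, ← mul_assoc, map_neg, neg_mul, hT, neg_neg,
      mul_assoc, ← map_mul]

/-- A homomorphism from the Clifford algebra of a non-degenerate quadratic form on a finite free
module is injective if it is injective on scalars and there is an invertible element that
anticommutes with the image of the module. -/
theorem injective_of_anticommute {m : ℕ} (hM : IsFreeOfRank R M m)
    (hQ : ∀ u : M, (∀ v : M, QuadraticMap.polar Q u v = 0) → u = 0)
    (hA : Function.Injective (algebraMap R A)) {T : A} (hT1 : IsUnit T)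
    (hT : ∀ v, φ (ι Q v) * T = -(T * φ (ι Q v))) : Function.Injective φ := by
  have hinj : Function.Injective (algebraMap R (CliffordAlgebra Q)) := by
    refine Function.Injective.of_comp (f := φ) ?_
    rwa [← RingHom.coe_coe φ, ← RingHom.coe_comp, AlgHom.comp_algebraMap]
  have key : ∀ k : ℕ, ∀ x ∈ contractLeftKer Q k, φ x = 0 → x = 0 := by
    intro k
    induction k with
    | zero => exact fun x hx _ => hx
    | succ k ih =>
      intro x hx hφ
      have hφ' : φ (involute x) = 0 := by
        rw [← hT1.mul_left_eq_zero, map_involute_mul φ hT, hφ, mul_zero]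
      -- The contraction of `x` by `polar v` lies in `ker φ` and one step lower in the filtration.
      have h0 := contractLeft_eq_zero_of_polarBilin hM (isFreeOfRank hM hinj) hQ
        (x := x) fun v => ih _ (mem_contractLeftKer_succ.1 hx _) (by
          rw [← ι_mul_sub_involute_mul_ι, map_sub, map_mul, map_mul, hφ, hφ', mul_zero, zero_mul,
            sub_zero])
      obtain ⟨b⟩ := hM
      obtain ⟨r, rfl⟩ := mem_range_algebraMap_of_contractLeft_eq_zero b h0
      rw [AlgHom.commutes] at hφ
      rw [(injective_iff_map_eq_zero _).1 hA r hφ, map_zero]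
  refine (injective_iff_map_eq_zero φ).2 fun x hx => ?_
  obtain ⟨k, hk⟩ := exists_mem_contractLeftKer x
  exact key k x hk hx

/-- The homomorphism induced by a map into the odd part of a graded algebra is graded. -/
theorem evenOdd_le_comap (𝒜 : ZMod 2 → Submodule R A) [SetLike.GradedMonoid 𝒜]
    (h : ∀ v, φ (ι Q v) ∈ 𝒜 1) (i : ZMod 2) :
    evenOdd Q i ≤ (𝒜 i).comap φ.toLinearMap := by
  refine iSup_le ?_
  rintro ⟨k, rfl⟩ y hy
  change y ∈ LinearMap.range (ι Q) ^ k at hy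
  change φ y ∈ 𝒜 (k : ZMod 2)
  induction hy using Submodule.pow_induction_on_left' with
  | algebraMap r =>
    rw [AlgHom.commutes, Nat.cast_zero]
    exact SetLike.algebraMap_mem_graded 𝒜 r
  | add x y k _ _ ihx ihy =>
    rw [map_add]
    exact add_mem ihx ihy
  | mem_mul m hm k x _ ih =>
    obtain ⟨v, rfl⟩ := hm
    rw [map_mul, Nat.cast_succ, add_comm]
    exact SetLike.mul_mem_graded (h v) ih

end AlgHom

end CliffordAlgebra

-- Composition algebra identities and the Clifford relation.

namespace IsCompositionAlgebra

variable {R O : Type*} [CommRing R] [NonAssocRing O] [Module R O] {q : QuadraticForm R O}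

theorem map_one (hq : IsCompositionAlgebra q) : q 1 = 1 := by
  have h : ∀ x, q 1 * q x = q x := fun x => by rw [← hq.map_mul, one_mul]
  -- `q 1 - 1` annihilates all values of `q`, hence of its polar form; non-degeneracy makes
  -- cancellation by a value unnecessary.
  have h0 : (q 1 - 1) • (1 : O) = 0 := hq.nondegenerate _ fun y => by
    rw [QuadraticMap.polar_smul_left, QuadraticMap.polar, smul_eq_mul]
    linear_combination h (1 + y) - h 1 - h y
  exact sub_eq_zero.1 (hq.injective_smul_one (by simpa using h0))

theorem polar_mul_mul_left (hq : IsCompositionAlgebra q) (x y z : O) :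
    QuadraticMap.polar q (x * y) (x * z) = q x * QuadraticMap.polar q y z := by
  simp only [QuadraticMap.polar, ← mul_add, hq.map_mul]
  ring

/-- Linearization of `polar_mul_mul_left` in its repeated factor. -/
theorem polar_mul_mul_add (hq : IsCompositionAlgebra q) (x y z w : O) :
    QuadraticMap.polar q (x * y) (z * w) + QuadraticMap.polar q (z * y) (x * w) =
      QuadraticMap.polar q x z * QuadraticMap.polar q y w := by
  have h := hq.polar_mul_mul_left (x + z) y w
  simp only [add_mul, QuadraticMap.polar_add_left, QuadraticMap.polar_add_right,
    hq.polar_mul_mul_left] at h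
  rw [show q (x + z) = QuadraticMap.polar q x z + q x + q z by rw [QuadraticMap.polar]; ring] at h
  linear_combination h

/-- The case `z = 1` of the linearized identity: `L_x̄` is the adjoint of `L_x`. -/
theorem polar_mul_left (hq : IsCompositionAlgebra q) [IsScalarTower R O O] (x y z : O) :
    QuadraticMap.polar q (x * y) z = QuadraticMap.polar q y (octConj q x * z) := by
  have h := hq.polar_mul_mul_add x y 1 z
  rw [one_mul, one_mul] at h
  rw [octConj, sub_mul, smul_mul_assoc, one_mul, QuadraticMap.polar_sub_right,
    QuadraticMap.polar_smul_right, smul_eq_mul]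
  linear_combination h

theorem octConj_octConj (hq : IsCompositionAlgebra q) (x : O) : octConj q (octConj q x) = x := by
  simp only [octConj, QuadraticMap.polar_sub_left, QuadraticMap.polar_smul_left,
    QuadraticMap.polar_self, hq.map_one]
  module

theorem octConj_mul_mul (hq : IsCompositionAlgebra q) [IsScalarTower R O O] (x y : O) :
    octConj q x * (x * y) = q x • y := by
  refine sub_eq_zero.1 (hq.nondegenerate _ fun z => ?_)
  rw [QuadraticMap.polar_sub_left, QuadraticMap.polar_smul_left, hq.polar_mul_left,
    hq.octConj_octConj, hq.polar_mul_mul_left, smul_eq_mul, sub_self]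

theorem map_octConj (hq : IsCompositionAlgebra q) (x : O) : q (octConj q x) = q x := by
  rw [octConj, sub_eq_add_neg, QuadraticMap.map_add q, QuadraticMap.map_neg, QuadraticMap.map_smul,
    QuadraticMap.polar_neg_right, QuadraticMap.polar_smul_left, QuadraticMap.polar_comm q 1 x,
    hq.map_one]
  simp

theorem mul_octConj_mul (hq : IsCompositionAlgebra q) [IsScalarTower R O O] (x y : O) :
    x * (octConj q x * y) = q x • y := by
  have h := hq.octConj_mul_mul (octConj q x) y
  rwa [hq.octConj_octConj, hq.map_octConj] at h

variable [IsScalarTower R O O] [SMulCommClass R O O]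

/-- The scalar blocks are central, so the off-diagonal terms cancel and each diagonal block gains
`aₙ bₙ`. The two orders need each other in the induction. -/
theorem octZ_mul_octZBar_and (hq : IsCompositionAlgebra q) (α : O) (n : ℕ) (v w : Fin n → R) :
    octZ q α n v w * octZBar q α n v w = (q α + v ⬝ᵥ w) • 1 ∧
      octZBar q α n v w * octZ q α n v w = (q α + v ⬝ᵥ w) • 1 := by
  induction n with
  | zero =>
    simp only [octZ, octZBar]
    constructor
    all_goals
      ext i j y
      -- The index type `Fin (2 ^ 0)` is `Fin 1` by computation.
      obtain rfl : i = j := Subsingleton.elim (α := Fin 1) i j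
      simp [Matrix.mul_apply, hq.mul_octConj_mul, hq.octConj_mul_mul]
  | succ n ih =>
    obtain ⟨h1, h2⟩ := ih (Fin.init v) (Fin.init w)
    have hvw : q α + v ⬝ᵥ w =
        q α + Fin.init v ⬝ᵥ Fin.init w + v (Fin.last n) * w (Fin.last n) := by
      simp [dotProduct, Fin.sum_univ_castSucc, Fin.init, add_assoc]
    rw [hvw, ← blockMatrix_one]
    simp only [octZ, octZBar, blockMatrix_mul, blockMatrix_smul, blockMatrix_inj, smul_zero,
      neg_mul, mul_neg, neg_neg, h1, h2, smul_mul_assoc, mul_smul_comm, one_mul, mul_one, smul_smul,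
      ← add_smul, neg_add_cancel, add_neg_cancel]
    simp only [add_comm, mul_comm, and_true, true_and]
    simp

theorem octPhi_mul_self (hq : IsCompositionAlgebra q) (n : ℕ)
    (x : O × ((Fin n → R) × (Fin n → R))) :
    octPhi q n x * octPhi q n x = algebraMap R _ (octSpaceForm q n x) := by
  obtain ⟨α, v, w⟩ := x
  obtain ⟨h1, h2⟩ := hq.octZ_mul_octZBar_and α n v w
  rw [octPhi, blockMatrix_mul, octSpaceForm_apply, Algebra.algebraMap_eq_smul_one,
    ← blockMatrix_one, blockMatrix_smul]
  simp [h1, h2]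

end IsCompositionAlgebra

-- Linearity of the matrix map.

section OctPhi

variable {R O : Type*} [CommRing R] [NonAssocRing O] [Module R O] {q : QuadraticForm R O}

theorem octConj_add (x y : O) : octConj q (x + y) = octConj q x + octConj q y := by
  simp only [octConj, QuadraticMap.polar_add_left]
  module

theorem octConj_smul (c : R) (x : O) : octConj q (c • x) = c • octConj q x := by
  simp only [octConj, QuadraticMap.polar_smul_left, smul_eq_mul]
  module

theorem blockMatrix_neg {E : Type*} [Ring E] {n : ℕ}
    (A B C D : Matrix (Fin (2 ^ n)) (Fin (2 ^ n)) E) :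
    -blockMatrix A B C D = blockMatrix (-A) (-B) (-C) (-D) := by
  simp only [blockMatrix, Matrix.reindex_apply, ← Matrix.fromBlocks_neg]
  rfl

variable [SMulCommClass R O O]

theorem octZ_add_and (α β : O) (n : ℕ) (v w v' w' : Fin n → R) :
    octZ q (α + β) n (v + v') (w + w') = octZ q α n v w + octZ q β n v' w' ∧
      octZBar q (α + β) n (v + v') (w + w') = octZBar q α n v w + octZBar q β n v' w' := by
  induction n with
  | zero =>
    simp only [octZ, octZBar]
    constructor
    all_goals
      ext i j y
      simp [octConj_add, add_mul]
  | succ n ih =>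
    obtain ⟨h1, h2⟩ := ih (Fin.init v) (Fin.init w) (Fin.init v') (Fin.init w')
    change octZ q (α + β) n (Fin.init (v + v')) (Fin.init (w + w')) = _ at h1
    change octZBar q (α + β) n (Fin.init (v + v')) (Fin.init (w + w')) = _ at h2
    simp only [octZ, octZBar, blockMatrix_add, h1, h2, Pi.add_apply, add_smul, neg_add, and_self]

variable [IsScalarTower R O O]

theorem octZ_smul_and (c : R) (α : O) (n : ℕ) (v w : Fin n → R) :
    octZ q (c • α) n (c • v) (c • w) = c • octZ q α n v w ∧
      octZBar q (c • α) n (c • v) (c • w) = c • octZBar q α n v w := by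
  induction n with
  | zero =>
    simp only [octZ, octZBar]
    constructor
    all_goals
      ext i j y
      simp [octConj_smul, smul_mul_assoc]
  | succ n ih =>
    obtain ⟨h1, h2⟩ := ih (Fin.init v) (Fin.init w)
    change octZ q (c • α) n (Fin.init (c • v)) (Fin.init (c • w)) = _ at h1
    change octZBar q (c • α) n (Fin.init (c • v)) (Fin.init (c • w)) = _ at h2
    simp only [octZ, octZBar, blockMatrix_smul, h1, h2, Pi.smul_apply, smul_eq_mul, mul_smul,
      smul_neg, and_self]

variable (q) in
/-- `octPhi` as a linear map. -/
def octPhiLinear (n : ℕ) : O × ((Fin n → R) × (Fin n → R)) →ₗ[R]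
    Matrix (Fin (2 ^ (n + 1))) (Fin (2 ^ (n + 1))) (Module.End R O) where
  toFun := octPhi q n
  map_add' x y := by
    obtain ⟨h1, h2⟩ := octZ_add_and (q := q) x.1 y.1 n x.2.1 x.2.2 y.2.1 y.2.2
    simp [octPhi, blockMatrix_add, h1, h2]
  map_smul' c x := by
    obtain ⟨h1, h2⟩ := octZ_smul_and (q := q) c x.1 n x.2.1 x.2.2
    simp [octPhi, blockMatrix_smul, h1, h2]

end OctPhi

-- Non-degeneracy of `V`, faithfulness of scalars, and the conclusion.

theorem polar_hyperbolicForm {R : Type*} [CommRing R] (n : ℕ) (v w v' w' : Fin n → R) :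
    QuadraticMap.polar (hyperbolicForm R n) (v, w) (v', w') = v ⬝ᵥ w' + v' ⬝ᵥ w := by
  rw [QuadraticMap.polar, Prod.mk_add_mk, hyperbolicForm_apply, hyperbolicForm_apply,
    hyperbolicForm_apply, add_dotProduct, dotProduct_add, dotProduct_add]
  ring

theorem eq_zero_of_polar_octSpaceForm {R O : Type*} [CommRing R] [NonAssocRing O] [Module R O]
    {q : QuadraticForm R O} (hq : IsCompositionAlgebra q) (n : ℕ)
    (x : O × ((Fin n → R) × (Fin n → R)))
    (h : ∀ y, QuadraticMap.polar (octSpaceForm q n) x y = 0) : x = 0 := by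
  obtain ⟨α, v, w⟩ := x
  have h' : ∀ β v' w', QuadraticMap.polar q α β + (v ⬝ᵥ w' + v' ⬝ᵥ w) = 0 := fun β v' w' => by
    rw [← polar_hyperbolicForm]
    simpa [octSpaceForm] using h (β, v', w')
  have h1 : α = 0 := hq.nondegenerate α fun β => by simpa using h' β 0 0
  have h2 : v = 0 := funext fun i => by simpa using h' 0 0 (Pi.single i 1)
  have h3 : w = 0 := funext fun i => by simpa using h' 0 (Pi.single i 1) 0
  rw [h1, h2, h3]
  rfl

theorem algebraMap_matrix_end_injective {R O : Type*} [CommRing R] [NonAssocRing O] [Module R O]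
    (h : Function.Injective fun r : R => r • (1 : O)) {m : ℕ} (i : Fin m) :
    Function.Injective (algebraMap R (Matrix (Fin m) (Fin m) (Module.End R O))) := by
  intro r s hrs
  refine h ?_
  have := congrFun (congrFun hrs i) i
  simpa [Matrix.algebraMap_matrix_apply] using LinearMap.congr_fun this (1 : O)

theorem theorem9p1 {R O : Type*} [CommRing R] [NonAssocRing O] [Module R O]
    [IsScalarTower R O O] [SMulCommClass R O O]
    (q : QuadraticForm R O) (hq : IsOctonionAlgebra q) (n : ℕ) :
    (∃ φ : GradedAlgHom R (CliffordAlgebra.evenOdd (octSpaceForm q n))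
        (blockGrading R (Module.End R O) n),
      (∀ x : O × ((Fin n → R) × (Fin n → R)),
        φ (CliffordAlgebra.ι (octSpaceForm q n) x) = octPhi q n x) ∧
      Function.Injective φ) ∧
    IsFreeOfRank R (CliffordAlgebra (octSpaceForm q n)) (2 ^ (2 * n + 8)) ∧
    IsFreeOfRank R (Matrix (Fin (2 ^ (n + 1))) (Fin (2 ^ (n + 1))) (Module.End R O))
      (2 ^ (2 * n + 8)) := by
  have hq' := hq.toIsCompositionAlgebra
  have hV : IsFreeOfRank R (O × ((Fin n → R) × (Fin n → R))) (2 * n + 8) := by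
    have hn : IsFreeOfRank R (Fin n → R) n := ⟨Pi.basisFun R (Fin n)⟩
    have h := hq.rank_eq.prod (hn.prod hn)
    rwa [← two_mul, add_comm] at h
  let φ : CliffordAlgebra (octSpaceForm q n) →ₐ[R]
      Matrix (Fin (2 ^ (n + 1))) (Fin (2 ^ (n + 1))) (Module.End R O) :=
    CliffordAlgebra.lift (octSpaceForm q n) ⟨octPhiLinear q n, hq'.octPhi_mul_self n⟩
  have hφ : ∀ x, φ (CliffordAlgebra.ι (octSpaceForm q n) x) = octPhi q n x := fun x =>
    CliffordAlgebra.lift_ι_apply _ _ x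
  have hA := algebraMap_matrix_end_injective (R := R) (O := O) hq'.injective_smul_one
    (⟨0, by positivity⟩ : Fin (2 ^ (n + 1)))
  have hinj : Function.Injective φ := by
    -- `diag(1, -1)` is its own inverse and anticommutes with every odd matrix.
    have hTT : blockMatrix (1 : Matrix (Fin (2 ^ n)) (Fin (2 ^ n)) (Module.End R O)) 0 0 (-1) *
        blockMatrix 1 0 0 (-1) = 1 := by
      simp [blockMatrix_mul, blockMatrix_one]
    refine CliffordAlgebra.injective_of_anticommute φ hV (eq_zero_of_polar_octSpaceForm hq' n) hA
      ⟨⟨_, _, hTT, hTT⟩, rfl⟩ fun x => ?_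
    rw [hφ, octPhi, blockMatrix_mul, blockMatrix_mul, blockMatrix_neg]
    simp
  refine ⟨⟨{ φ with
    map_mem := fun hx => CliffordAlgebra.evenOdd_le_comap φ _
      (fun x => (mem_blockGrading_one R).2 ⟨_, _, hφ x⟩) _ hx }, hφ, hinj⟩, ?_, ?_⟩
  · refine CliffordAlgebra.isFreeOfRank hV (Function.Injective.of_comp (f := φ) ?_)
    rwa [← RingHom.coe_coe φ, ← RingHom.coe_comp, AlgHom.comp_algebraMap]
  · have h := hq.rank_eq.end.matrix (2 ^ (n + 1)) (2 ^ (n + 1))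
    have h2 : 2 ^ (n + 1) * 2 ^ (n + 1) * (8 * 8) = 2 ^ (2 * n + 8) := by ring
    rwa [h2] at h
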